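/- Let $\mathcal A$ be a (complex, not necessarily unital) $C^*$-algebra; all ideals are closed and two-sided. For a $C^*$-algebra $\mathcal B$, let $\mathcal I^{At}(\mathcal B)$ be the $C^*$-subalgebra (in fact an ideal) of $\mathcal B$ generated by its minimal projections, i.e. the nonzero projections $p$ with $p\mathcal Bp=\mathbb Cp$, and let $CCR(\mathcal B)$ be the ideal of all elements of $\mathcal B$ that every irreducible representation of $\mathcal B$ sends to a compact operator. The algebra $\mathcal A$ is scattered if $\mathcal I^{At}(\mathcal B)\neq\{0\}$ for every nonzero $C^*$-subalgebra $\mathcal B\subseteq\mathcal A$. Its Cantor–Bendixson sequence is given by $\mathcal I_0=\{0\}$, $\mathcal I_{\alpha+1}=\{a\in\mathcal A:[a]_{\mathcal I_\alpha}\in\mathcal I^{At}(\mathcal A/\mathcal I_\alpha)\}$ and $\mathcal I_\lambda=\overline{\bigcup_{\alpha<\lambda}\mathcal I_\alpha}$ for limit ordinals $\lambda$; its height $ht(\mathcal A)$ is the least ordinal $\alpha$ with $\mathcal I_{\alpha}=\mathcal A$. A scattered $C^*$-algebra $\mathcal A$ is fully noncommutative if for every $\alpha<ht(\mathcal A)$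 (i.e. as long as $\mathcal I_\alpha\ne\mathcal A$) the quotient $\mathcal I_{\alpha+1}/\mathcal I_\alpha$ is $*$-isomorphic to the algebra of all compact operators on a nonzero Hilbert space. A GCR composition series of $\mathcal A$ is a strictly increasing sequence of ideals $(\mathcal J_\alpha)_{\alpha\le\alpha_0}$, for some ordinal $\alpha_0$, such that $\mathcal J_0=\{0\}$, $\mathcal J_{\alpha_0}=\mathcal A$, $\mathcal J_\lambda=\overline{\bigcup_{\alpha<\lambda}\mathcal J_\alpha}$ for each limit ordinal $\lambda\le\alpha_0$, and $\{[a]_{\mathcal J_\alpha}:a\in\mathcal J_{\alpha+1}\}=CCR(\mathcal A/\mathcal J_\alpha)$ for each $\alpha<\alpha_0$. **Proposition.** Suppose that $\mathcal A$ is a fully noncommutative scattered $C^*$-algebra. Then its Cantor–Bendixson sequence and its GCR composition series coincide. That is: the Cantor–Bendixson sequence $(\mathcal I_\alpha)_{\alpha\le ht(\mathcal A)}$ is a strictly increasing continuous sequence of ideals from $\{0\}$ to $\mathcal A$, it is a GCR composition series of $\mathcal A$, and every GCR composition series $(\mathcal J_\alpha)_{\alpha\le\alpha_0}$ of $\mathcal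 A$ satisfies $\alpha_0=ht(\mathcal A)$ and $\mathcal J_\alpha=\mathcal I_\alpha$ for all $\alpha\le ht(\mathcal A)$. -/

import Mathlib

universe u

open Filter Topology

/-- A closed two-sided ideal of a (complex, not necessarily unital) C*-algebra. -/
structure ClosedIdeal (A : Type u) [NonUnitalCStarAlgebra A] extends Submodule ℂ A where
  mul_mem_left' : ∀ (a : A) {x : A}, x ∈ carrier → a * x ∈ carrier
  mul_mem_right' : ∀ (a : A) {x : A}, x ∈ carrier → x * a ∈ carrier
  isClosed' : IsClosed carrier

namespace ClosedIdeal

variable {A : Type u} [NonUnitalCStarAlgebra A]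

instance : SetLike (ClosedIdeal A) A where
  coe I := I.carrier
  coe_injective I J h := by
    cases I; cases J; congr; exact SetLike.coe_injective h

instance : AddSubgroupClass (ClosedIdeal A) A where
  add_mem {I} _ _ := I.toSubmodule.add_mem
  zero_mem I := I.toSubmodule.zero_mem
  neg_mem {I} _ := I.toSubmodule.neg_mem

@[ext] theorem ext {I J : ClosedIdeal A} (h : ∀ x, x ∈ I ↔ x ∈ J) : I = J := SetLike.ext h

theorem mem_toSubmodule {I : ClosedIdeal A} {x : A} : x ∈ I.toSubmodule ↔ x ∈ I := Iff.rfl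

variable (I : ClosedIdeal A)

theorem smul_mem (c : ℂ) {x : A} (hx : x ∈ I) : c • x ∈ I := I.toSubmodule.smul_mem c hx
theorem mul_mem_left (a : A) {x : A} (hx : x ∈ I) : a * x ∈ I := I.mul_mem_left' a hx
theorem mul_mem_right (a : A) {x : A} (hx : x ∈ I) : x * a ∈ I := I.mul_mem_right' a hx
theorem isClosed : IsClosed (I : Set A) := I.isClosed'

instance : IsClosed (I.toSubmodule : Set A) := I.isClosed'

/-- The ideal `{0}`. -/
instance : Bot (ClosedIdeal A) where
  bot :=
    { (⊥ : Submodule ℂ A) with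
      mul_mem_left' := by
        rintro a x (rfl : x = 0)
        exact mul_zero a
      mul_mem_right' := by
        rintro a x (rfl : x = 0)
        exact zero_mul a
      isClosed' := isClosed_singleton }

/-- The ideal `A`. -/
instance : Top (ClosedIdeal A) where
  top :=
    { (⊤ : Submodule ℂ A) with
      mul_mem_left' := fun _ _ _ => trivial
      mul_mem_right' := fun _ _ _ => trivial
      isClosed' := isClosed_univ }

theorem mem_bot {x : A} : x ∈ (⊥ : ClosedIdeal A) ↔ x = 0 := Iff.rfl
theorem mem_top {x : A} : x ∈ (⊤ : ClosedIdeal A) := trivial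

/-- Closed two-sided ideals of C*-algebras are self-adjoint. -/
theorem star_mem {x : A} (hx : x ∈ I) : star x ∈ I := by
  set h : A := star x * x with hh
  have hsa : star h = h := by simp [hh]
  have hI : h ∈ I := I.mul_mem_left _ hx
  have key : ∀ y ∈ NonUnitalStarAlgebra.adjoin ℂ ({h} : Set A), y ∈ I ∧ star y ∈ I := by
    intro y hy
    induction hy using NonUnitalStarAlgebra.adjoin_induction with
    | mem y hy =>
      obtain rfl : y = h := hy
      exact ⟨hI, by rwa [hsa]⟩
    | add y z _ _ h1 h2 =>
      exact ⟨add_mem h1.1 h2.1, by rw [star_add]; exact add_mem h1.2 h2.2⟩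
    | zero => exact ⟨zero_mem I, by rw [star_zero]; exact zero_mem I⟩
    | mul y z _ _ h1 h2 =>
      exact ⟨I.mul_mem_left _ h2.1, by rw [star_mul]; exact I.mul_mem_left _ h1.2⟩
    | smul c y _ h1 =>
      exact ⟨I.smul_mem c h1.1, by rw [star_smul]; exact I.smul_mem _ h1.2⟩
    | star y _ h1 => exact ⟨h1.2, by rw [star_star]; exact h1.1⟩
  let B := NonUnitalStarAlgebra.elemental ℂ h
  have hB : ∀ y ∈ B, y ∈ I := by
    intro y hy
    have hy' : y ∈ closure (NonUnitalStarAlgebra.adjoin ℂ ({h} : Set A) : Set A) := hy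
    exact I.isClosed.closure_subset_iff.2 (fun z hz => (key z hz).1) hy'
  let _ : PartialOrder B := CStarAlgebra.spectralOrder B
  have _ : StarOrderedRing B := CStarAlgebra.spectralOrderedRing B
  let l := CStarAlgebra.approximateUnit B
  have hl := CStarAlgebra.increasingApproximateUnit B
  let hb : B := ⟨h, NonUnitalStarAlgebra.elemental.self_mem ℂ h⟩
  have hs : ∀ᶠ e : B in l, star (e : A) = e := by
    filter_upwards [hl.eventually_star_eq] with e he
    exact congrArg Subtype.val he
  have t1 : Tendsto (fun e : B => (e : A) * h) l (𝓝 h) :=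
    (continuous_subtype_val.tendsto hb).comp (hl.tendsto_mul_right hb)
  have t2 : Tendsto (fun e : B => h * (e : A)) l (𝓝 h) :=
    (continuous_subtype_val.tendsto hb).comp (hl.tendsto_mul_left hb)
  have t3 : Tendsto (fun e : B => (e : A) * h * (e : A)) l (𝓝 h) := by
    rw [tendsto_iff_norm_sub_tendsto_zero]
    have t4 : Tendsto (fun e : B => ‖(e : A) * h - h‖ + ‖h * (e : A) - h‖) l (𝓝 0) := by
      simpa using (tendsto_iff_norm_sub_tendsto_zero.1 t1).add
        (tendsto_iff_norm_sub_tendsto_zero.1 t2)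
    refine squeeze_zero' (Eventually.of_forall fun _ => norm_nonneg _) ?_ t4
    filter_upwards [hl.eventually_norm] with e he
    have he' : ‖(e : A)‖ ≤ 1 := he
    calc ‖(e : A) * h * e - h‖ = ‖((e : A) * h - h) * e + (h * e - h)‖ := by
          congr 1; rw [sub_mul]; abel
      _ ≤ ‖((e : A) * h - h) * e‖ + ‖h * e - h‖ := norm_add_le _ _
      _ ≤ ‖(e : A) * h - h‖ + ‖h * e - h‖ := by
          gcongr
          exact (norm_mul_le _ _).trans (mul_le_of_le_one_right (norm_nonneg _) he')
  have t5 : Tendsto (fun e : B => h - h * (e : A) - (e : A) * h + (e : A) * h * (e : A)) l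
      (𝓝 0) := by
    simpa using (((tendsto_const_nhds (x := h)).sub t2).sub t1).add t3
  have t6 : Tendsto (fun e : B => (e : A) * star x) l (𝓝 (star x)) := by
    rw [tendsto_iff_norm_sub_tendsto_zero]
    have t7 := (continuous_norm.tendsto _).comp t5
    rw [norm_zero] at t7
    have t8 := (Real.continuous_sqrt.tendsto _).comp t7
    rw [Real.sqrt_zero] at t8
    refine t8.congr' ?_
    filter_upwards [hs] with e he
    have : h - h * (e : A) - (e : A) * h + (e : A) * h * (e : A)
        = ((e : A) * star x - star x) * star ((e : A) * star x - star x) := by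
      simp only [star_sub, star_mul, star_star, he, sub_mul, mul_sub, hh, mul_assoc]
      abel
    simp only [Function.comp, this]
    rw [CStarRing.norm_self_mul_star, Real.sqrt_mul_self (norm_nonneg _)]
  exact I.isClosed.mem_of_tendsto t6
    (Eventually.of_forall fun e => I.mul_mem_right _ (hB _ e.2))

/-- A closed ideal as a (closed) `*`-subalgebra. -/
def toStarSubalgebra : NonUnitalStarSubalgebra ℂ A where
  carrier := I
  add_mem' := add_mem
  zero_mem' := zero_mem I
  mul_mem' := fun _ hy => I.mul_mem_left _ hy
  smul_mem' := fun c _ hx => I.smul_mem c hx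
  star_mem' := fun hx => I.star_mem hx

instance : IsClosed (I.toStarSubalgebra : Set A) := I.isClosed'

/-- The quotient `A / I`, with the quotient norm. -/
def Quotient : Type u := A ⧸ I.toSubmodule

namespace Quotient

noncomputable instance : NormedAddCommGroup I.Quotient :=
  inferInstanceAs (NormedAddCommGroup (A ⧸ I.toSubmodule))

noncomputable instance : NormedSpace ℂ I.Quotient :=
  inferInstanceAs (NormedSpace ℂ (A ⧸ I.toSubmodule))

instance : CompleteSpace I.Quotient :=
  inferInstanceAs (CompleteSpace (A ⧸ I.toSubmodule))

/-- The class `[a]` of `a` in `A / I`. -/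
def mk (a : A) : I.Quotient := Submodule.Quotient.mk a

variable {I}

theorem mk_surjective : Function.Surjective (mk I) := Submodule.Quotient.mk_surjective _

theorem mk_eq_mk {a b : A} : mk I a = mk I b ↔ a - b ∈ I := Submodule.Quotient.eq _

instance : Mul I.Quotient where
  mul := Quotient.map₂ (· * ·) (by
    intro a a' ha b b' hb
    refine (Submodule.quotientRel_def _).2 ?_
    replace ha := (Submodule.quotientRel_def _).1 ha
    replace hb := (Submodule.quotientRel_def _).1 hb
    have : a * b - a' * b' = (a - a') * b + a' * (b - b') := by
      rw [sub_mul, mul_sub]; abel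
    rw [this]
    exact add_mem (I.mul_mem_right _ ha) (I.mul_mem_left _ hb))

instance : Star I.Quotient where
  star := Quotient.map star (by
    intro a a' ha
    refine (Submodule.quotientRel_def _).2 ?_
    replace ha := (Submodule.quotientRel_def _).1 ha
    rw [← star_sub]
    exact I.star_mem ha)

theorem mk_mul (a b : A) : mk I (a * b) = mk I a * mk I b := rfl
theorem mk_star (a : A) : mk I (star a) = star (mk I a) := rfl
theorem mk_add (a b : A) : mk I (a + b) = mk I a + mk I b := rfl
theorem mk_zero : mk I 0 = 0 := rfl
theorem mk_smul (c : ℂ) (a : A) : mk I (c • a) = c • mk I a := rfl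

theorem norm_mk_le (a : A) : ‖mk I a‖ ≤ ‖a‖ := Submodule.Quotient.norm_mk_le _ a

theorem exists_norm_lt (x : I.Quotient) {ε : ℝ} (hε : 0 < ε) :
    ∃ a, mk I a = x ∧ ‖a‖ < ‖x‖ + ε := Submodule.Quotient.norm_mk_lt x hε

theorem norm_mul_le' (x y : I.Quotient) : ‖x * y‖ ≤ ‖x‖ * ‖y‖ := by
  have key : ∀ ε : ℝ, 0 < ε → ‖x * y‖ ≤ (‖x‖ + ε) * (‖y‖ + ε) := by
    intro ε hε
    obtain ⟨a, rfl, ha⟩ := exists_norm_lt x hε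
    obtain ⟨b, rfl, hb⟩ := exists_norm_lt y hε
    rw [← mk_mul]
    exact (norm_mk_le _).trans ((norm_mul_le _ _).trans (by gcongr))
  have ht : Tendsto (fun ε : ℝ => (‖x‖ + ε) * (‖y‖ + ε)) (𝓝[>] 0) (𝓝 (‖x‖ * ‖y‖)) := by
    have : Continuous fun ε : ℝ => (‖x‖ + ε) * (‖y‖ + ε) := by fun_prop
    simpa using (this.tendsto 0).mono_left nhdsWithin_le_nhds
  exact ge_of_tendsto ht (by filter_upwards [self_mem_nhdsWithin] with ε hε using key ε hε)

/-- The C*-inequality for the quotient norm. -/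
theorem norm_mk_sq_le (x i : A) (hi : i ∈ I) :
    ‖mk I x‖ * ‖mk I x‖ ≤ ‖star x * x + i‖ := by
  let B := I.toStarSubalgebra
  let _ : PartialOrder B := CStarAlgebra.spectralOrder B
  have _ : StarOrderedRing B := CStarAlgebra.spectralOrderedRing B
  let _ : PartialOrder A := CStarAlgebra.spectralOrder A
  have _ : StarOrderedRing A := CStarAlgebra.spectralOrderedRing A
  let l := CStarAlgebra.approximateUnit B
  have hl := CStarAlgebra.increasingApproximateUnit B
  let ib : B := ⟨i, hi⟩
  have hs : ∀ᶠ e : B in l, star (e : A) = e := by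
    filter_upwards [hl.eventually_star_eq] with e he
    exact congrArg Subtype.val he
  have hpos : ∀ᶠ e : B in l, 0 ≤ (e : A) := by
    filter_upwards [hl.eventually_nonneg] with e he
    obtain ⟨b, rfl⟩ := CStarAlgebra.nonneg_iff_eq_star_mul_self.1 he
    exact star_mul_self_nonneg (b : A)
  have t1 : Tendsto (fun e : B => i - i * (e : A)) l (𝓝 0) := by
    have : Tendsto (fun e : B => i * (e : A)) l (𝓝 i) :=
      (continuous_subtype_val.tendsto ib).comp (hl.tendsto_mul_left ib)
    simpa using (tendsto_const_nhds (x := i)).sub this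
  have t2 : Tendsto (fun e : B => ‖star x * x + i‖ + 2 * ‖i - i * (e : A)‖) l
      (𝓝 ‖star x * x + i‖) := by
    simpa using tendsto_const_nhds.add ((t1.norm).const_mul 2)
  refine ge_of_tendsto t2 ?_
  filter_upwards [hs, hpos, hl.eventually_norm] with e he hep hen
  have he1 : ‖(e : A)‖ ≤ 1 := hen
  have contr : ‖(1 : Unitization ℂ A) - (e : A)‖ ≤ 1 := by
    have h1 : (((e : A) : A) : Unitization ℂ A) ∈ Set.Icc (0 : Unitization ℂ A) 1 :=
      CStarAlgebra.mem_Icc_iff_norm_le_one.2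
        ⟨Unitization.inr_nonneg_iff.2 hep, by rwa [Unitization.norm_inr]⟩
    exact (CStarAlgebra.mem_Icc_iff_norm_le_one.1
      (Set.sub_mem_Icc_zero_iff_right.mpr h1)).2
  have left : ∀ y : A, ‖y - (e : A) * y‖ ≤ ‖y‖ := by
    intro y
    have : ((y - (e : A) * y : A) : Unitization ℂ A) = (1 - ((e : A) : Unitization ℂ A)) * y := by
      simp [sub_mul]
    rw [← Unitization.norm_inr (𝕜 := ℂ), this]
    refine (norm_mul_le _ _).trans ?_
    rw [Unitization.norm_inr]
    exact mul_le_of_le_one_left (norm_nonneg _) contr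
  have right : ∀ y : A, ‖y - y * (e : A)‖ ≤ ‖y‖ := by
    intro y
    have := left (star y)
    rwa [← norm_star, star_sub, star_mul, star_star, he, norm_star] at this
  have hx : mk I x = mk I (x - x * e) := by
    rw [mk_eq_mk]
    simpa using I.mul_mem_left x e.2
  have expand : star (x - x * e) * (x - x * e)
      = (((star x * x + i) - (star x * x + i) * e) - e * ((star x * x + i) - (star x * x + i) * e))
        - ((i - i * e) - e * (i - i * e)) := by
    simp only [star_sub, star_mul, he, sub_mul, mul_sub, add_mul, mul_add, mul_assoc]
    abel
  calc ‖mk I x‖ * ‖mk I x‖ ≤ ‖x - x * e‖ * ‖x - x * e‖ := by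
        rw [hx]
        gcongr <;> exact norm_mk_le _
    _ = ‖star (x - x * e) * (x - x * e)‖ := CStarRing.norm_star_mul_self.symm
    _ ≤ _ := by
        rw [expand]
        refine (norm_sub_le _ _).trans ?_
        have a1 := (left ((star x * x + i) - (star x * x + i) * e)).trans (right _)
        have a2 := left (i - i * e)
        have a3 := norm_nonneg (i - i * (e : A))
        linarith

noncomputable instance : NonUnitalRing I.Quotient where
  left_distrib := by
    intro x y z
    obtain ⟨a, rfl⟩ := mk_surjective x
    obtain ⟨b, rfl⟩ := mk_surjective y
    obtain ⟨c, rfl⟩ := mk_surjective z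
    exact congrArg (mk I) (mul_add a b c)
  right_distrib := by
    intro x y z
    obtain ⟨a, rfl⟩ := mk_surjective x
    obtain ⟨b, rfl⟩ := mk_surjective y
    obtain ⟨c, rfl⟩ := mk_surjective z
    exact congrArg (mk I) (add_mul a b c)
  zero_mul := by
    intro x
    obtain ⟨a, rfl⟩ := mk_surjective x
    exact congrArg (mk I) (zero_mul a)
  mul_zero := by
    intro x
    obtain ⟨a, rfl⟩ := mk_surjective x
    exact congrArg (mk I) (mul_zero a)
  mul_assoc := by
    intro x y z
    obtain ⟨a, rfl⟩ := mk_surjective x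
    obtain ⟨b, rfl⟩ := mk_surjective y
    obtain ⟨c, rfl⟩ := mk_surjective z
    exact congrArg (mk I) (mul_assoc a b c)

noncomputable instance : NonUnitalNormedRing I.Quotient where
  dist_eq := NormedAddCommGroup.dist_eq
  norm_mul_le := norm_mul_le'

noncomputable instance : StarRing I.Quotient where
  star_involutive := by
    intro x
    obtain ⟨a, rfl⟩ := mk_surjective x
    exact congrArg (mk I) (star_star a)
  star_mul := by
    intro x y
    obtain ⟨a, rfl⟩ := mk_surjective x
    obtain ⟨b, rfl⟩ := mk_surjective y
    exact congrArg (mk I) (star_mul a b)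
  star_add := by
    intro x y
    obtain ⟨a, rfl⟩ := mk_surjective x
    obtain ⟨b, rfl⟩ := mk_surjective y
    exact congrArg (mk I) (star_add a b)

/-- The quotient of a C*-algebra by a closed ideal is a C*-algebra. -/
noncomputable instance : NonUnitalCStarAlgebra I.Quotient where
  norm_mul_self_le := by
    intro x
    obtain ⟨a, rfl⟩ := mk_surjective x
    refine le_of_forall_pos_le_add fun ε hε => ?_
    obtain ⟨b, hb, hlt⟩ := exists_norm_lt (star (mk I a) * mk I a) hε
    have hmem : b - star a * a ∈ I := mk_eq_mk.1 hb
    have := norm_mk_sq_le a _ hmem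
    rw [add_sub_cancel] at this
    exact this.trans hlt.le
  smul_assoc := by
    intro c x y
    obtain ⟨a, rfl⟩ := mk_surjective x
    obtain ⟨b, rfl⟩ := mk_surjective y
    exact congrArg (mk I) (smul_mul_assoc c a b)
  smul_comm := by
    intro c x y
    obtain ⟨a, rfl⟩ := mk_surjective x
    obtain ⟨b, rfl⟩ := mk_surjective y
    exact congrArg (mk I) (mul_smul_comm c a b).symm
  star_smul := by
    intro c x
    obtain ⟨a, rfl⟩ := mk_surjective x
    exact congrArg (mk I) (star_smul c a)

end Quotient

/-- The quotient map `A → A / I`. -/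
noncomputable def mkHom : A →⋆ₙₐ[ℂ] I.Quotient where
  toFun := Quotient.mk I
  map_smul' _ _ := rfl
  map_zero' := rfl
  map_add' _ _ := rfl
  map_mul' _ _ := rfl
  map_star' _ := rfl

theorem continuous_mkHom : Continuous I.mkHom :=
  AddMonoidHomClass.continuous_of_bound I.mkHom 1 fun a => by
    rw [one_mul]
    exact Quotient.norm_mk_le a

/-- The ideal `{a ∈ A : [a] ∈ K}` of `A`, for an ideal `K` of `A / I`. -/
noncomputable def pullback (K : ClosedIdeal I.Quotient) : ClosedIdeal A where
  carrier := {a | I.mkHom a ∈ K}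
  add_mem' := fun {a b} ha hb => by
    change I.mkHom (a + b) ∈ K
    rw [map_add]
    exact add_mem ha hb
  zero_mem' := by
    change I.mkHom 0 ∈ K
    rw [map_zero]
    exact zero_mem K
  smul_mem' := fun c a ha => by
    change I.mkHom (c • a) ∈ K
    rw [map_smul]
    exact K.smul_mem c ha
  mul_mem_left' := fun a x hx => by
    change I.mkHom (a * x) ∈ K
    rw [map_mul]
    exact K.mul_mem_left _ hx
  mul_mem_right' := fun a x hx => by
    change I.mkHom (x * a) ∈ K
    rw [map_mul]
    exact K.mul_mem_right _ hx
  isClosed' := K.isClosed.preimage I.continuous_mkHom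

/-- The quotient `J / I = {[a] : a ∈ J}`, as a `*`-subalgebra of `A / I`. -/
noncomputable def subquotient (J : ClosedIdeal A) : NonUnitalStarSubalgebra ℂ I.Quotient :=
  J.toStarSubalgebra.map I.mkHom

/-- The closed ideal generated by a family of closed ideals: the closure of its sum. For a
family that is linearly ordered by inclusion, the sum is the union. -/
def closedSup {ι : Type*} (K : ι → ClosedIdeal A) : ClosedIdeal A where
  toSubmodule := (⨆ i, (K i).toSubmodule).topologicalClosure
  mul_mem_left' := fun a x hx => by
    refine map_mem_closure (f := fun y => a * y) (by fun_prop) hx fun y hy => ?_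
    refine Submodule.iSup_induction _ (motive := fun y => a * y ∈ ⨆ i, (K i).toSubmodule) hy
      (fun i z hz => Submodule.mem_iSup_of_mem i ((K i).mul_mem_left a hz)) (by simp)
      fun y z h1 h2 => ?_
    rw [mul_add]
    exact add_mem h1 h2
  mul_mem_right' := fun a x hx => by
    refine map_mem_closure (f := fun y => y * a) (by fun_prop) hx fun y hy => ?_
    refine Submodule.iSup_induction _ (motive := fun y => y * a ∈ ⨆ i, (K i).toSubmodule) hy
      (fun i z hz => Submodule.mem_iSup_of_mem i ((K i).mul_mem_right a hz)) (by simp)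
      fun y z h1 h2 => ?_
    rw [add_mul]
    exact add_mem h1 h2
  isClosed' := Submodule.isClosed_topologicalClosure _

end ClosedIdeal

section Atoms

variable {A : Type u} [NonUnitalCStarAlgebra A]

/-- A (nonzero) projection `p` with `p A p = ℂ p`. -/
structure IsMinimalProjection (p : A) : Prop where
  isStarProjection : IsStarProjection p
  ne_zero : p ≠ 0
  exists_smul : ∀ a : A, ∃ c : ℂ, p * a * p = c • p

theorem IsMinimalProjection.of_star_mul_self {p x : A} (hp : IsMinimalProjection p) {r : ℂ}
    (hr0 : r ≠ 0) (hr : star r = r) (hxp : x * p = x) (hx : star x * x = r • p) :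
    IsMinimalProjection (r⁻¹ • (x * star x)) := by
  have hps : star p = p := hp.isStarProjection.isSelfAdjoint
  have hpx : p * star x = star x := by rw [← hps, ← star_mul, hxp]
  refine ⟨⟨?_, ?_⟩, ?_, ?_⟩
  · show r⁻¹ • (x * star x) * r⁻¹ • (x * star x) = r⁻¹ • (x * star x)
    have : x * star x * (x * star x) = r • (x * star x) := by
      calc x * star x * (x * star x) = x * (star x * x) * star x := by simp only [mul_assoc]
        _ = _ := by rw [hx, mul_smul_comm, smul_mul_assoc, hxp]
    rw [smul_mul_smul_comm, this, smul_smul]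
    congr 1
    field_simp
  · show star (r⁻¹ • (x * star x)) = _
    rw [star_smul, star_mul, star_star, star_inv₀, hr]
  · intro h0
    rw [smul_eq_zero] at h0
    rcases h0 with h0 | h0
    · exact hr0 (inv_eq_zero.1 h0)
    · have : x = 0 := CStarRing.mul_star_self_eq_zero_iff _ |>.1 h0
      rw [this, mul_zero] at hx
      exact (smul_ne_zero hr0 hp.ne_zero) hx.symm
  · intro a
    obtain ⟨c, hc⟩ := hp.exists_smul (star x * a * x)
    refine ⟨r⁻¹ * c, ?_⟩
    have : x * star x * a * (x * star x) = c • (x * star x) := by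
      calc x * star x * a * (x * star x) = (x * p) * (star x * a * x) * (p * star x) := by
            rw [hxp, hpx]; simp only [mul_assoc]
        _ = x * (p * (star x * a * x) * p) * star x := by simp only [mul_assoc]
        _ = _ := by rw [hc, mul_smul_comm, smul_mul_assoc, hxp]
    rw [smul_mul_assoc, smul_mul_assoc, mul_smul_comm, this, smul_smul, smul_smul, smul_smul]
    congr 1
    ring

theorem IsMinimalProjection.exists_nonneg {p : A} (hp : IsMinimalProjection p) (a : A) :
    ∃ r : ℝ, 0 ≤ r ∧ star (a * p) * (a * p) = (r : ℂ) • p := by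
  let _ : PartialOrder A := CStarAlgebra.spectralOrder A
  have _ : StarOrderedRing A := CStarAlgebra.spectralOrderedRing A
  have hps : star p = p := hp.isStarProjection.isSelfAdjoint
  have hpp : p * p = p := hp.isStarProjection.isIdempotentElem
  obtain ⟨c, hc⟩ := hp.exists_smul (star a * a)
  have hx : star (a * p) * (a * p) = c • p := by
    rw [← hc, star_mul, hps]; simp only [mul_assoc]
  have hcs : star c = c := by
    have h1 : star (c • p) = c • p := by rw [← hx]; simp
    rw [star_smul, hps] at h1
    exact smul_left_injective ℂ hp.ne_zero h1
  obtain ⟨r, rfl⟩ : ∃ r : ℝ, (r : ℂ) = c := ⟨c.re, Complex.conj_eq_iff_re.1 hcs⟩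
  rcases le_or_gt 0 r with h | h
  · exact ⟨r, h, hx⟩
  · exfalso
    have h1 : (0 : A) ≤ ((r : ℝ) : ℂ) • p := hx ▸ star_mul_self_nonneg _
    have h2 : (0 : A) ≤ -(((r : ℝ) : ℂ) • p) := by
      have h3 := star_mul_self_nonneg (((Real.sqrt (-r) : ℝ) : ℂ) • p)
      rw [star_smul, hps, smul_mul_smul_comm, hpp] at h3
      have h4 : star ((Real.sqrt (-r) : ℝ) : ℂ) * ((Real.sqrt (-r) : ℝ) : ℂ) = -(r : ℂ) := by
        rw [Complex.star_def, Complex.conj_ofReal, ← Complex.ofReal_mul,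
          Real.mul_self_sqrt (by linarith)]
        simp
      rwa [h4, neg_smul] at h3
    have h5 : ((r : ℝ) : ℂ) • p = 0 := le_antisymm (neg_nonneg.1 h2) h1
    rw [smul_eq_zero] at h5
    rcases h5 with h5 | h5
    · exact h.ne (by exact_mod_cast h5)
    · exact hp.ne_zero h5

theorem IsMinimalProjection.mul_mem_adjoin {p : A} (hp : IsMinimalProjection p) (a : A) :
    a * p ∈ NonUnitalStarAlgebra.adjoin ℂ {q : A | IsMinimalProjection q} := by
  set S := NonUnitalStarAlgebra.adjoin ℂ {q : A | IsMinimalProjection q}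
  have hS : ∀ q : A, IsMinimalProjection q → q ∈ S := fun q hq =>
    NonUnitalStarAlgebra.subset_adjoin ℂ _ hq
  have hps : star p = p := hp.isStarProjection.isSelfAdjoint
  have hpp : p * p = p := hp.isStarProjection.isIdempotentElem
  obtain ⟨r, hr, hx⟩ := hp.exists_nonneg a
  obtain ⟨c, hc⟩ := hp.exists_smul a
  have hxp : a * p * p = a * p := by rw [mul_assoc, hpp]
  rw [mul_assoc] at hc
  generalize a * p = x at *
  rcases hr.eq_or_lt with rfl | hr
  · have : x = 0 := by
      rw [Complex.ofReal_zero, zero_smul] at hx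
      exact CStarRing.star_mul_self_eq_zero_iff _ |>.1 hx
    rw [this]
    exact zero_mem S
  have hrC : (r : ℂ) ≠ 0 := by exact_mod_cast hr.ne'
  have hrs : star (r : ℂ) = r := Complex.conj_ofReal r
  have hpx : p * star x = star x := by rw [← hps, ← star_mul, hxp]
  have hxsp : star x * p = star c • p := by
    rw [← hps, ← star_mul, hc, star_smul]
  set q : A := (r : ℂ)⁻¹ • (x * star x) with hq
  have hqm : IsMinimalProjection q := hp.of_star_mul_self hrC hrs hxp hx
  have hqx : q * x = x := by
    rw [hq, smul_mul_assoc, mul_assoc, hx, mul_smul_comm, hxp, smul_smul,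
      inv_mul_cancel₀ hrC, one_smul]
  have hqp : q * p = ((r : ℂ)⁻¹ * star c) • x := by
    rw [hq, smul_mul_assoc, mul_assoc, hxsp, mul_smul_comm, hxp, smul_smul]
  by_cases h0 : c = 0
  · subst h0
    rw [zero_smul] at hc
    rw [star_zero, zero_smul] at hxsp
    rw [star_zero, mul_zero, zero_smul] at hqp
    set s : ℂ := (((Real.sqrt r)⁻¹ : ℝ) : ℂ) with hs
    have hs0 : s ≠ 0 := by
      have := (Real.sqrt_pos.2 hr).ne'
      rw [hs]
      exact_mod_cast inv_ne_zero this
    have hss : star s = s := Complex.conj_ofReal _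
    have hsr : s * s * r = 1 := by
      rw [hs, ← Complex.ofReal_mul, ← Complex.ofReal_mul, ← mul_inv, Real.mul_self_sqrt hr.le,
        inv_mul_cancel₀ hr.ne', Complex.ofReal_one]
    have hw1 : (p + s • x) * p = p + s • x := by
      rw [add_mul, hpp, smul_mul_assoc, hxp]
    have hw2 : star (p + s • x) * (p + s • x) = (2 : ℂ) • p := by
      rw [star_add, star_smul, hps, hss, add_mul, mul_add, mul_add, hpp, mul_smul_comm, hc,
        smul_mul_assoc, hxsp, smul_mul_smul_comm, hx, smul_smul, hsr, two_smul]
      simp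
    have hm := hp.of_star_mul_self (two_ne_zero) (by simp) hw1 hw2
    have hprod : q * ((2 : ℂ)⁻¹ • ((p + s • x) * star (p + s • x))) * p
        = ((2 : ℂ)⁻¹ * s) • x := by
      have h1 : star (p + s • x) * p = p := by
        rw [star_add, star_smul, hps, hss, add_mul, hpp, smul_mul_assoc, hxsp, smul_zero,
          add_zero]
      have h2 : q * (p + s • x) = s • x := by
        rw [mul_add, hqp, mul_smul_comm, hqx, zero_add]
      calc q * ((2 : ℂ)⁻¹ • ((p + s • x) * star (p + s • x))) * p
          = (2 : ℂ)⁻¹ • ((q * (p + s • x)) * (star (p + s • x) * p)) := by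
            rw [mul_smul_comm, smul_mul_assoc]; simp only [mul_assoc]
        _ = _ := by rw [h1, h2, smul_mul_assoc, hxp, smul_smul]
    have hmem : ((2 : ℂ)⁻¹ * s) • x ∈ S := by
      rw [← hprod]
      exact mul_mem (mul_mem (hS _ hqm) (hS _ hm)) (hS _ hp)
    have := SMulMemClass.smul_mem (s := S) ((2 : ℂ)⁻¹ * s)⁻¹ hmem
    rwa [smul_smul, inv_mul_cancel₀ (mul_ne_zero (by norm_num) hs0), one_smul] at this
  · have hne : (r : ℂ)⁻¹ * star c ≠ 0 :=
      mul_ne_zero (inv_ne_zero hrC) (star_ne_zero.2 h0)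
    have hmem : ((r : ℂ)⁻¹ * star c) • x ∈ S := by
      rw [← hqp]
      exact mul_mem (hS _ hqm) (hS _ hp)
    have := SMulMemClass.smul_mem (s := S) ((r : ℂ)⁻¹ * star c)⁻¹ hmem
    rwa [smul_smul, inv_mul_cancel₀ hne, one_smul] at this

theorem mul_mem_adjoin_minimalProjections {y : A}
    (hy : y ∈ NonUnitalStarAlgebra.adjoin ℂ {q : A | IsMinimalProjection q}) :
    ∀ a : A, a * y ∈ NonUnitalStarAlgebra.adjoin ℂ {q : A | IsMinimalProjection q} ∧
      y * a ∈ NonUnitalStarAlgebra.adjoin ℂ {q : A | IsMinimalProjection q} := by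
  induction hy using NonUnitalStarAlgebra.adjoin_induction with
  | mem p hp =>
    intro a
    refine ⟨IsMinimalProjection.mul_mem_adjoin hp a, ?_⟩
    have := star_mem (IsMinimalProjection.mul_mem_adjoin hp (star a))
    rwa [star_mul, star_star,
      (hp.isStarProjection.isSelfAdjoint : star p = p)] at this
  | add y z _ _ h1 h2 =>
    intro a
    rw [mul_add, add_mul]
    exact ⟨add_mem (h1 a).1 (h2 a).1, add_mem (h1 a).2 (h2 a).2⟩
  | zero =>
    intro a
    rw [mul_zero, zero_mul]
    exact ⟨zero_mem _, zero_mem _⟩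
  | mul y z hy hz h1 h2 =>
    intro a
    rw [← mul_assoc, mul_assoc y]
    exact ⟨mul_mem (h1 a).1 hz, mul_mem hy (h2 a).2⟩
  | smul c y _ h1 =>
    intro a
    rw [mul_smul_comm, smul_mul_assoc]
    exact ⟨SMulMemClass.smul_mem c (h1 a).1, SMulMemClass.smul_mem c (h1 a).2⟩
  | star y _ h1 =>
    intro a
    have h2 := star_mem (h1 (star a)).1
    have h3 := star_mem (h1 (star a)).2
    rw [star_mul, star_star] at h2 h3
    exact ⟨h3, h2⟩

variable (A)

/-- `I^At(A)`: the C*-subalgebra (norm-closed `*`-subalgebra) of `A` generated by the minimal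
projections of `A`. -/
noncomputable def atomicSubalgebra : NonUnitalStarSubalgebra ℂ A :=
  (NonUnitalStarAlgebra.adjoin ℂ {p : A | IsMinimalProjection p}).topologicalClosure

/-- `I^At(A)`, as a closed ideal of `A`. -/
noncomputable def atomicIdeal : ClosedIdeal A where
  carrier := atomicSubalgebra A
  add_mem' := add_mem
  zero_mem' := zero_mem _
  smul_mem' := fun c _ hx => SMulMemClass.smul_mem c hx
  mul_mem_left' := fun a x hx =>
    map_mem_closure (f := fun y => a * y) (by fun_prop) hx fun _ hy =>
      (mul_mem_adjoin_minimalProjections hy a).1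
  mul_mem_right' := fun a x hx =>
    map_mem_closure (f := fun y => y * a) (by fun_prop) hx fun _ hy =>
      (mul_mem_adjoin_minimalProjections hy a).2
  isClosed' := NonUnitalStarSubalgebra.isClosed_topologicalClosure _

/-- `A` is scattered if `I^At(B) ≠ {0}` for every nonzero C*-subalgebra `B` of `A`. -/
def IsScattered : Prop :=
  ∀ (B : NonUnitalStarSubalgebra ℂ A) [IsClosed (B : Set A)], B ≠ ⊥ → atomicIdeal B ≠ ⊥

end Atoms

section Compact

/-- The algebra `K(H)` of compact operators on a Hilbert space, as a closed ideal of `B(H)`. -/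
def compactIdeal (H : Type u) [NormedAddCommGroup H] [InnerProductSpace ℂ H] [CompleteSpace H] :
    ClosedIdeal (H →L[ℂ] H) where
  carrier := {T | IsCompactOperator T}
  add_mem' := fun hS hT => IsCompactOperator.add hS hT
  zero_mem' := isCompactOperator_zero
  smul_mem' := fun c _ hT => IsCompactOperator.smul hT c
  mul_mem_left' := fun S _ hT => IsCompactOperator.clm_comp hT S
  mul_mem_right' := fun S _ hT => IsCompactOperator.comp_clm hT S
  isClosed' := isClosed_setOfPred_isCompactOperator

variable {A : Type u} [NonUnitalCStarAlgebra A]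

/-- A representation is irreducible if the only closed invariant subspaces are the trivial ones. -/
def IsIrreducibleRep {H : Type u} [NormedAddCommGroup H] [InnerProductSpace ℂ H] [CompleteSpace H]
    (π : A →⋆ₙₐ[ℂ] (H →L[ℂ] H)) : Prop :=
  ∀ V : Submodule ℂ H, IsClosed (V : Set H) → (∀ a : A, ∀ v ∈ V, π a v ∈ V) → V = ⊥ ∨ V = ⊤

variable (A)

/-- `CCR(A)`: the ideal of all elements that every irreducible representation of `A` on a Hilbert
space sends to a compact operator. Every irreducible representation is cyclic, hence unitarily
equivalent to one on a Hilbert space in the universe of `A`. -/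
def ccrIdeal : ClosedIdeal A where
  carrier := {a | ∀ (H : Type u) [NormedAddCommGroup H] [InnerProductSpace ℂ H]
    [CompleteSpace H] (π : A →⋆ₙₐ[ℂ] (H →L[ℂ] H)), IsIrreducibleRep π → π a ∈ compactIdeal H}
  add_mem' := fun {a b} ha hb H _ _ _ π hπ => by
    rw [map_add]
    exact add_mem (ha H π hπ) (hb H π hπ)
  zero_mem' := fun H _ _ _ π hπ => by
    rw [map_zero]
    exact zero_mem _
  smul_mem' := fun c a ha H _ _ _ π hπ => by
    rw [map_smul]
    exact (compactIdeal H).smul_mem c (ha H π hπ)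
  mul_mem_left' := fun b a ha H _ _ _ π hπ => by
    rw [map_mul]
    exact (compactIdeal H).mul_mem_left _ (ha H π hπ)
  mul_mem_right' := fun b a ha H _ _ _ π hπ => by
    rw [map_mul]
    exact (compactIdeal H).mul_mem_right _ (ha H π hπ)
  isClosed' := by
    simp only [Set.ofPred_forall]
    exact isClosed_iInter fun H => isClosed_iInter fun _ => isClosed_iInter fun _ =>
      isClosed_iInter fun _ => isClosed_iInter fun π => isClosed_iInter fun _ =>
        (compactIdeal H).isClosed.preimage
          (AddMonoidHomClass.continuous_of_bound π 1 fun a => by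
            rw [one_mul]
            exact NonUnitalStarAlgHom.norm_apply_le π a)

end Compact

section Series

variable (A : Type u) [NonUnitalCStarAlgebra A]

/-- The Cantor-Bendixson sequence of `A`: `I₀ = {0}`, `I_{α+1} = {a : [a] ∈ I^At(A / I_α)}`, and
`I_λ` is the closure of `⋃ α < λ, I_α` at limit ordinals `λ`. It is defined at all ordinals. -/
noncomputable def cbIdeal (α : Ordinal.{u}) : ClosedIdeal A :=
  Ordinal.limitRecOn α ⊥
    (fun _ I => I.pullback (atomicIdeal I.Quotient))
    (fun l _ I => ClosedIdeal.closedSup fun β : Set.Iio l => I β.1 β.2)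

/-- The Cantor-Bendixson height `ht(A)`: the least ordinal `α` with `I_α = A`. -/
noncomputable def cbHeight : Ordinal.{u} := sInf {α | cbIdeal A α = ⊤}

/-- A scattered C*-algebra is fully noncommutative if, for each `α` below its Cantor-Bendixson
height (that is, as long as `I_α ≠ A`), `I_{α+1} / I_α` is `*`-isomorphic to the algebra of all
compact operators on a (nonzero) Hilbert space. -/
def IsFullyNoncommutative : Prop :=
  IsScattered A ∧ ∀ α : Ordinal.{u}, cbIdeal A α ≠ ⊤ →
    ∃ (H : Type u) (_ : NormedAddCommGroup H) (_ : InnerProductSpace ℂ H) (_ : CompleteSpace H),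
      Nontrivial H ∧
        Nonempty ((cbIdeal A α).subquotient (cbIdeal A (α + 1)) ≃⋆ₐ[ℂ]
          (compactIdeal H).toStarSubalgebra)

variable {A}

/-- `(J_α)_{α ≤ γ}` is a strictly increasing continuous sequence of closed ideals from `{0}` to
`A` such that `{[a] : a ∈ J_{α+1}} = D(A / J_α)` for all `α < γ`. Only the values `J α` with
`α ≤ γ` matter. -/
structure IsCompositionSeries (D : ∀ (B : Type u) [NonUnitalCStarAlgebra B], ClosedIdeal B)
    (γ : Ordinal.{u}) (J : Ordinal.{u} → ClosedIdeal A) : Prop where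
  zero : J 0 = ⊥
  top : J γ = ⊤
  strictMono : ∀ α β, α < β → β ≤ γ → (J α : Set A) ⊂ J β
  limit : ∀ l ≤ γ, Order.IsSuccLimit l → (J l : Set A) = closure (⋃ α < l, (J α : Set A))
  succ : ∀ α < γ, (J α).mkHom '' (J (α + 1)) = (D (J α).Quotient : Set (J α).Quotient)

/-- `(J_α)_{α ≤ γ}` is the Cantor-Bendixson sequence of `A`. -/
def IsCantorBendixsonSeries (γ : Ordinal.{u}) (J : Ordinal.{u} → ClosedIdeal A) : Prop :=
  IsCompositionSeries (fun B _ => atomicIdeal B) γ J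

/-- `(J_α)_{α ≤ γ}` is a GCR composition series of `A`. -/
def IsGCRSeries (γ : Ordinal.{u}) (J : Ordinal.{u} → ClosedIdeal A) : Prop :=
  IsCompositionSeries (fun B _ => ccrIdeal B) γ J

end Series
/-!
Let `I_α` be the Cantor-Bendixson sequence. If `N` is an ideal with `N ∩ I_{α+1} ⊆ I_α`, then
`N ∩ I_β ⊆ I_α` for all `β`: at a successor step, a minimal projection of `A / I_β` that does not
annihilate `N` has a representative in `N`, and this representative is also a minimal projection
modulo `I_α`. As the sequence exhausts `A`, the ideal `I^At(A / I_α)` is therefore essential.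

Minimal projections have rank at most one in every irreducible representation, so
`I^At(B) ⊆ CCR(B)`. Conversely, an isomorphism of an essential ideal `J` of `B` with `K(H)` extends
to an irreducible representation `π` of `B` on `H`, which is faithful since `J` is essential; if
`π b` is compact, then `π b = π j` for some `j ∈ J`, whence `b = j`. Thus `CCR(B) ⊆ J`.

For `B = A / I_α` and `J = I^At(B)` this shows that the two series satisfy the same recursion, which
determines a composition series completely.
-/

namespace ClosedIdeal

variable {A : Type u} [NonUnitalCStarAlgebra A]

section Order

instance : PartialOrder (ClosedIdeal A) := .ofSetLike (ClosedIdeal A) A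

instance : BoundedOrder (ClosedIdeal A) where
  le_top _ _ _ := mem_top
  bot_le I _ hx := mem_bot.1 hx ▸ zero_mem I

instance : SemilatticeInf (ClosedIdeal A) where
  inf I J :=
    { I.toSubmodule ⊓ J.toSubmodule with
      mul_mem_left' := fun a _ hx => ⟨I.mul_mem_left a hx.1, J.mul_mem_left a hx.2⟩
      mul_mem_right' := fun a _ hx => ⟨I.mul_mem_right a hx.1, J.mul_mem_right a hx.2⟩
      isClosed' := I.isClosed.inter J.isClosed }
  inf_le_left _ _ _ hx := hx.1
  inf_le_right _ _ _ hx := hx.2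
  le_inf _ _ _ hJ hK _ hx := ⟨hJ hx, hK hx⟩

theorem le_closedSup {ι : Type*} (K : ι → ClosedIdeal A) (i : ι) : K i ≤ closedSup K := fun _ ha =>
  Submodule.le_topologicalClosure _ (Submodule.mem_iSup_of_mem i ha)

theorem closedSup_le {ι : Type*} {K : ι → ClosedIdeal A} {I : ClosedIdeal A} (h : ∀ i, K i ≤ I) :
    closedSup K ≤ I :=
  Submodule.topologicalClosure_minimal _ (iSup_le fun i _ ha => h i ha) I.isClosed

theorem coe_closedSup_of_directed {ι : Type*} [Nonempty ι] {K : ι → ClosedIdeal A}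
    (hK : Directed (· ≤ ·) K) : (closedSup K : Set A) = closure (⋃ i, (K i : Set A)) :=
  congrArg closure <| Submodule.coe_iSup_of_directed (fun i => (K i).toSubmodule) hK

theorem nontrivial_toStarSubalgebra_iff {I : ClosedIdeal A} :
    Nontrivial I.toStarSubalgebra ↔ I ≠ ⊥ := by
  refine ⟨?_, fun h => ?_⟩
  · rintro hI rfl
    obtain ⟨x, hx⟩ := exists_ne (0 : (⊥ : ClosedIdeal A).toStarSubalgebra)
    exact hx (Subtype.ext (mem_bot.1 x.2))
  · obtain ⟨x, hxI, hx⟩ := SetLike.exists_of_lt (bot_lt_iff_ne_bot.2 h)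
    exact ⟨⟨x, hxI⟩, 0, fun h0 => hx (congrArg Subtype.val h0)⟩

end Order

section Quotient

variable {I : ClosedIdeal A}

theorem mkHom_eq_zero {a : A} : I.mkHom a = 0 ↔ a ∈ I := by
  rw [← map_zero I.mkHom]
  exact Quotient.mk_eq_mk.trans (by rw [sub_zero])

theorem mkHom_eq_mkHom {a b : A} : I.mkHom a = I.mkHom b ↔ a - b ∈ I := Quotient.mk_eq_mk

theorem mkHom_surjective (I : ClosedIdeal A) : Function.Surjective I.mkHom :=
  Quotient.mk_surjective

theorem mem_pullback {K : ClosedIdeal I.Quotient} {a : A} :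
    a ∈ I.pullback K ↔ I.mkHom a ∈ K := Iff.rfl

theorem le_pullback (K : ClosedIdeal I.Quotient) : I ≤ I.pullback K := fun _ ha =>
  mem_pullback.2 (mkHom_eq_zero.2 ha ▸ zero_mem K)

theorem image_mkHom_pullback (K : ClosedIdeal I.Quotient) :
    I.mkHom '' (I.pullback K) = (K : Set I.Quotient) :=
  Set.image_preimage_eq (K : Set I.Quotient) I.mkHom_surjective

theorem subquotient_pullback (K : ClosedIdeal I.Quotient) :
    I.subquotient (I.pullback K) = K.toStarSubalgebra :=
  SetLike.coe_injective (image_mkHom_pullback K)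

theorem pullback_eq_of_image_mkHom_eq {J : ClosedIdeal A} {K : ClosedIdeal I.Quotient}
    (hIJ : I ≤ J) (h : I.mkHom '' J = (K : Set I.Quotient)) : I.pullback K = J := by
  refine SetLike.coe_injective (Set.Subset.antisymm (fun a ha => ?_) fun a ha => ?_)
  · obtain ⟨b, hbJ, hba⟩ : I.mkHom a ∈ I.mkHom '' J := h ▸ ha
    have : b - a ∈ J := hIJ (mkHom_eq_mkHom.1 hba)
    exact sub_sub_cancel b a ▸ sub_mem hbJ this
  · exact h.subset ⟨a, ha, rfl⟩

theorem pullback_le_iff {K : ClosedIdeal I.Quotient} : I.pullback K ≤ I ↔ K = ⊥ := by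
  refine ⟨fun h => le_bot_iff.1 fun x hx => ?_, ?_⟩
  · obtain ⟨a, rfl⟩ := I.mkHom_surjective x
    exact mkHom_eq_zero.2 (h hx)
  · rintro rfl a ha
    exact mkHom_eq_zero.1 ha

end Quotient

section Colon

/-- The ideal `{y : x A y ⊆ I}`, that is, the ideal quotient of `I` by the right ideal `x A`. -/
def colon (I : ClosedIdeal A) (x : A) : ClosedIdeal A where
  carrier := {y | ∀ b, x * b * y ∈ I}
  add_mem' hy hz b := by rw [mul_add]; exact add_mem (hy b) (hz b)
  zero_mem' b := by rw [mul_zero]; exact zero_mem I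
  smul_mem' c y hy b := by rw [mul_smul_comm]; exact I.smul_mem c (hy b)
  mul_mem_left' a y hy b := by rw [← mul_assoc, mul_assoc x]; exact hy (b * a)
  mul_mem_right' a y hy b := by rw [← mul_assoc]; exact I.mul_mem_right a (hy b)
  isClosed' := by
    simp only [Set.ofPred_forall]
    exact isClosed_iInter fun b => I.isClosed.preimage (continuous_const_mul (x * b))

theorem mem_of_mem_colon_self {I : ClosedIdeal A} {x : A} (hx : x ∈ I.colon x) : x ∈ I := by
  have h : I.mkHom x * star (I.mkHom x) * I.mkHom x = 0 := by
    rw [← map_star, ← map_mul, ← map_mul, mkHom_eq_zero]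
    exact hx (star x)
  have h' : star (star (I.mkHom x) * I.mkHom x) * (star (I.mkHom x) * I.mkHom x) = 0 := by
    rw [star_mul, star_star, mul_assoc, ← mul_assoc (I.mkHom x), h, mul_zero]
  rwa [CStarRing.star_mul_self_eq_zero_iff, CStarRing.star_mul_self_eq_zero_iff,
    mkHom_eq_zero] at h'

theorem inf_closedSup_le {ι : Type*} {K : ι → ClosedIdeal A} {I N : ClosedIdeal A}
    (h : ∀ i, N ⊓ K i ≤ I) : N ⊓ closedSup K ≤ I := by
  rintro x ⟨hxN, hxK⟩
  have hK : closedSup K ≤ I.colon x := closedSup_le fun i y hy b =>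
    h i ⟨N.mul_mem_right _ (N.mul_mem_right _ hxN), (K i).mul_mem_left _ hy⟩
  exact mem_of_mem_colon_self (hK hxK)

end Colon

/-- A closed ideal is essential if it meets every nonzero closed ideal nontrivially. -/
def IsEssential (J : ClosedIdeal A) : Prop := ∀ N : ClosedIdeal A, N ⊓ J = ⊥ → N = ⊥

end ClosedIdeal

section MinimalProjections

variable {A : Type u} [NonUnitalCStarAlgebra A]

theorem IsMinimalProjection.mem_atomicIdeal {p : A} (hp : IsMinimalProjection p) :
    p ∈ atomicIdeal A :=
  subset_closure (NonUnitalStarAlgebra.subset_adjoin ℂ _ hp)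

theorem atomicIdeal_le {I : ClosedIdeal A} (h : ∀ p, IsMinimalProjection p → p ∈ I) :
    atomicIdeal A ≤ I :=
  NonUnitalStarSubalgebra.topologicalClosure_minimal _
    (NonUnitalStarAlgebra.adjoin_le (S := I.toStarSubalgebra) h) I.isClosed

theorem exists_isMinimalProjection_mul_mul {x : A} (hx : x ∈ atomicIdeal A) (hx0 : x ≠ 0) :
    ∃ a b, IsMinimalProjection (a * x * b) := by
  obtain ⟨p, hp, b, hb⟩ : ∃ p, IsMinimalProjection p ∧ ∃ b, x * b * p ≠ 0 := by
    by_contra! h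
    have hle : atomicIdeal A ≤ (⊥ : ClosedIdeal A).colon x := atomicIdeal_le h
    exact hx0 (ClosedIdeal.mem_of_mem_colon_self (hle hx))
  obtain ⟨r, -, hr⟩ := hp.exists_nonneg (x * b)
  have hr0 : (r : ℂ) ≠ 0 := fun h0 => by
    rw [h0, zero_smul] at hr
    exact hb (CStarRing.star_mul_self_eq_zero_iff _ |>.1 hr)
  refine ⟨(r : ℂ)⁻¹ • star (x * b * p), b * p, ?_⟩
  have : (r : ℂ)⁻¹ • star (x * b * p) * x * (b * p) = p := by
    rw [mul_assoc, ← mul_assoc x, smul_mul_assoc, hr, inv_smul_smul₀ hr0]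
  rwa [this]

namespace ClosedIdeal

variable {I K N : ClosedIdeal A}

theorem exists_mem_isMinimalProjection_mkHom {x : A} (hxN : x ∈ N)
    (hx : x ∈ K.pullback (atomicIdeal K.Quotient)) (hxK : x ∉ K) :
    ∃ n ∈ N, IsMinimalProjection (K.mkHom n) := by
  obtain ⟨a', b', hp⟩ := exists_isMinimalProjection_mul_mul hx (mt mkHom_eq_zero.1 hxK)
  obtain ⟨a, rfl⟩ := K.mkHom_surjective a'
  obtain ⟨b, rfl⟩ := K.mkHom_surjective b'
  exact ⟨a * x * b, N.mul_mem_right b (N.mul_mem_left a hxN), by rwa [map_mul, map_mul]⟩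

theorem isMinimalProjection_mkHom_of_inf_le (hIK : I ≤ K) (hN : N ⊓ K ≤ I) {n : A} (hn : n ∈ N)
    (hK : IsMinimalProjection (K.mkHom n)) : IsMinimalProjection (I.mkHom n) := by
  have lift_eq {x y : A} (hx : x ∈ N) (hy : y ∈ N) (h : K.mkHom x = K.mkHom y) :
      I.mkHom x = I.mkHom y :=
    mkHom_eq_mkHom.2 (hN ⟨sub_mem hx hy, mkHom_eq_mkHom.1 h⟩)
  refine ⟨⟨?_, ?_⟩, fun h => hK.ne_zero (mkHom_eq_zero.2 (hIK (mkHom_eq_zero.1 h))), fun x => ?_⟩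
  · have h := hK.isStarProjection.isIdempotentElem
    rw [IsIdempotentElem, ← map_mul] at h ⊢
    exact lift_eq (N.mul_mem_left _ hn) hn h
  · have h := hK.isStarProjection.isSelfAdjoint
    rw [isSelfAdjoint_iff, ← map_star] at h ⊢
    exact lift_eq (N.star_mem hn) hn h
  · obtain ⟨a, rfl⟩ := I.mkHom_surjective x
    obtain ⟨c, hc⟩ := hK.exists_smul (K.mkHom a)
    refine ⟨c, ?_⟩
    rw [← map_mul, ← map_mul, ← map_smul] at hc ⊢
    exact lift_eq (N.mul_mem_left _ hn) (N.smul_mem c hn) hc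

theorem inf_pullback_atomicIdeal_le (hIK : I ≤ K) (hNK : N ⊓ K ≤ I)
    (hNI : N ⊓ I.pullback (atomicIdeal I.Quotient) ≤ I) :
    N ⊓ K.pullback (atomicIdeal K.Quotient) ≤ I := by
  rintro x ⟨hxN, hx⟩
  suffices hxK : x ∈ K from hNK ⟨hxN, hxK⟩
  by_contra hxK
  obtain ⟨n, hnN, hn⟩ := exists_mem_isMinimalProjection_mkHom hxN hx hxK
  have hnI := isMinimalProjection_mkHom_of_inf_le hIK hNK hnN hn
  exact hnI.ne_zero (mkHom_eq_zero.2 (hNI ⟨hnN, hnI.mem_atomicIdeal⟩))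

end ClosedIdeal

end MinimalProjections

section CantorBendixson

variable (A : Type u) [NonUnitalCStarAlgebra A]

theorem cbIdeal_zero : cbIdeal A 0 = ⊥ := Ordinal.limitRecOn_zero ..

theorem cbIdeal_add_one (α : Ordinal.{u}) :
    cbIdeal A (α + 1) = (cbIdeal A α).pullback (atomicIdeal (cbIdeal A α).Quotient) :=
  Ordinal.limitRecOn_add_one ..

theorem cbIdeal_limit {l : Ordinal.{u}} (hl : Order.IsSuccLimit l) :
    cbIdeal A l = ClosedIdeal.closedSup fun β : Set.Iio l => cbIdeal A β.1 :=
  Ordinal.limitRecOn_limit _ _ _ _ hl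

theorem monotone_cbIdeal : Monotone (cbIdeal A) := by
  intro α β hαβ
  induction β using Ordinal.limitRecOn with
  | zero => rw [nonpos_iff_eq_zero.1 hαβ]
  | add_one β ih =>
    rcases hαβ.eq_or_lt with rfl | hαβ
    · exact le_rfl
    · rw [cbIdeal_add_one]
      exact (ih (Order.lt_add_one_iff.1 hαβ)).trans (ClosedIdeal.le_pullback _)
  | limit β hβ ih =>
    rcases hαβ.eq_or_lt with rfl | hαβ
    · exact le_rfl
    · rw [cbIdeal_limit A hβ]
      exact ClosedIdeal.le_closedSup (fun γ : Set.Iio β => cbIdeal A γ.1) ⟨α, hαβ⟩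

theorem coe_cbIdeal_limit {l : Ordinal.{u}} (hl : Order.IsSuccLimit l) :
    (cbIdeal A l : Set A) = closure (⋃ α < l, (cbIdeal A α : Set A)) := by
  have : Nonempty (Set.Iio l) := ⟨⟨0, hl.bot_lt⟩⟩
  have hdir : Directed (· ≤ ·) fun β : Set.Iio l => cbIdeal A β.1 :=
    Monotone.directed_le fun _ _ h => monotone_cbIdeal A h
  rw [cbIdeal_limit A hl, ClosedIdeal.coe_closedSup_of_directed hdir]
  exact congrArg closure (Set.iUnion_subtype (· < l) fun β => (cbIdeal A β.1 : Set A))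

variable {A}

theorem inf_cbIdeal_le {α : Ordinal.{u}} {N : ClosedIdeal A}
    (hN : N ⊓ cbIdeal A (α + 1) ≤ cbIdeal A α) (β : Ordinal.{u}) :
    N ⊓ cbIdeal A β ≤ cbIdeal A α := by
  induction β using Ordinal.limitRecOn with
  | zero => exact inf_le_right.trans (monotone_cbIdeal A zero_le)
  | add_one β ih =>
    rcases lt_or_ge β α with hβ | hβ
    · exact inf_le_right.trans (monotone_cbIdeal A (Order.add_one_le_of_lt hβ))
    · rw [cbIdeal_add_one] at hN ⊢
      exact ClosedIdeal.inf_pullback_atomicIdeal_le (monotone_cbIdeal A hβ) ih hN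
  | limit β hβ ih =>
    rw [cbIdeal_limit A hβ]
    exact ClosedIdeal.inf_closedSup_le fun γ : Set.Iio β => ih γ.1 γ.2

theorem isEssential_atomicIdeal_quotient {γ : Ordinal.{u}} (hγ : cbIdeal A γ = ⊤)
    (α : Ordinal.{u}) : (atomicIdeal (cbIdeal A α).Quotient).IsEssential := by
  intro N hN
  have hinf : (cbIdeal A α).pullback N ⊓ cbIdeal A (α + 1) ≤ cbIdeal A α := by
    rw [cbIdeal_add_one]
    exact fun x hx => ClosedIdeal.mkHom_eq_zero.1 (hN.le hx)
  have h := inf_cbIdeal_le hinf γ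
  rwa [hγ, inf_top_eq, ClosedIdeal.pullback_le_iff] at h

theorem cbIdeal_lt_cbIdeal {α β : Ordinal.{u}} (h : atomicIdeal (cbIdeal A α).Quotient ≠ ⊥)
    (hαβ : α < β) : cbIdeal A α < cbIdeal A β := by
  have hα : cbIdeal A α < cbIdeal A (α + 1) := by
    refine lt_of_le_not_ge (monotone_cbIdeal A le_self_add) ?_
    rwa [cbIdeal_add_one, ClosedIdeal.pullback_le_iff]
  exact hα.trans_le (monotone_cbIdeal A (Order.add_one_le_of_lt hαβ))

theorem cbIdeal_ne_top_of_lt_cbHeight {α : Ordinal.{u}} (hα : α < cbHeight A) :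
    cbIdeal A α ≠ ⊤ :=
  fun h => notMem_of_lt_csInf' hα h

theorem cbIdeal_cbHeight
    (hA : ∀ α, cbIdeal A α ≠ ⊤ → atomicIdeal (cbIdeal A α).Quotient ≠ ⊥) :
    cbIdeal A (cbHeight A) = ⊤ := by
  suffices h : ∃ α, cbIdeal A α = ⊤ from csInf_mem h
  by_contra! h
  have hmono : StrictMono (cbIdeal A) := fun α _ hαβ => cbIdeal_lt_cbIdeal (hA α (h α)) hαβ
  exact not_injective_of_ordinal (cbIdeal A) hmono.injective

theorem isCantorBendixsonSeries_cbIdeal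
    (hA : ∀ α, cbIdeal A α ≠ ⊤ → atomicIdeal (cbIdeal A α).Quotient ≠ ⊥) :
    IsCantorBendixsonSeries (cbHeight A) (cbIdeal A) where
  zero := cbIdeal_zero A
  top := cbIdeal_cbHeight hA
  strictMono α β hαβ hβ :=
    have hα : cbIdeal A α ≠ ⊤ := cbIdeal_ne_top_of_lt_cbHeight (hαβ.trans_le hβ)
    SetLike.coe_ssubset_coe.2 (cbIdeal_lt_cbIdeal (hA α hα) hαβ)
  limit _ _ hl := coe_cbIdeal_limit A hl
  succ α _ := by rw [cbIdeal_add_one, ClosedIdeal.image_mkHom_pullback]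

end CantorBendixson

namespace IsCompositionSeries

variable {A : Type u} [NonUnitalCStarAlgebra A]
  {D D' : ∀ (B : Type u) [NonUnitalCStarAlgebra B], ClosedIdeal B}
  {γ γ' : Ordinal.{u}} {J J' : Ordinal.{u} → ClosedIdeal A}

theorem congr (hJ : IsCompositionSeries D γ J)
    (h : ∀ α < γ, D (J α).Quotient = D' (J α).Quotient) : IsCompositionSeries D' γ J :=
  { hJ with succ := fun α hα => h α hα ▸ hJ.succ α hα }

theorem ne_top_of_lt (hJ : IsCompositionSeries D γ J) {α : Ordinal.{u}} (hα : α < γ) : J α ≠ ⊤ :=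
  (SetLike.coe_ssubset_coe.1 (hJ.strictMono α γ hα le_rfl)).ne_top

theorem pullback_eq (hJ : IsCompositionSeries D γ J) {α : Ordinal.{u}} (hα : α < γ) :
    (J α).pullback (D (J α).Quotient) = J (α + 1) :=
  have hlt := hJ.strictMono α (α + 1) (lt_add_one α) (Order.add_one_le_of_lt hα)
  ClosedIdeal.pullback_eq_of_image_mkHom_eq (SetLike.coe_ssubset_coe.1 hlt).le (hJ.succ α hα)

theorem eq_of_le (hJ : IsCompositionSeries D γ J) (hJ' : IsCompositionSeries D γ' J')
    {α : Ordinal.{u}} (hα : α ≤ γ) (hα' : α ≤ γ') : J α = J' α := by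
  induction α using Ordinal.limitRecOn with
  | zero => rw [hJ.zero, hJ'.zero]
  | add_one α ih =>
    rw [Order.add_one_le_iff] at hα hα'
    rw [← hJ.pullback_eq hα, ← hJ'.pullback_eq hα', ih hα.le hα'.le]
  | limit l hl ih =>
    refine SetLike.coe_injective ?_
    rw [hJ.limit l hα hl, hJ'.limit l hα' hl]
    exact congrArg closure <| Set.iUnion₂_congr fun β hβ => by
      rw [ih β hβ (hβ.le.trans hα) (hβ.le.trans hα')]

theorem length_le (hJ : IsCompositionSeries D γ J) (hJ' : IsCompositionSeries D γ' J') :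
    γ ≤ γ' := by
  by_contra! h
  exact hJ.ne_top_of_lt h ((hJ.eq_of_le hJ' h.le le_rfl).trans hJ'.top)

theorem unique (hJ : IsCompositionSeries D γ J) (hJ' : IsCompositionSeries D γ' J') :
    γ = γ' ∧ ∀ α ≤ γ, J α = J' α :=
  have hγ := (hJ.length_le hJ').antisymm (hJ'.length_le hJ)
  ⟨hγ, fun _ hα => hJ.eq_of_le hJ' hα (hα.trans_eq hγ)⟩

end IsCompositionSeries

section Representations

open InnerProductSpace
open scoped CStarAlgebra

theorem isCompactOperator_of_forall_apply_mem {E F : Type*} [NormedAddCommGroup E]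
    [NormedSpace ℂ E] [NormedAddCommGroup F] [NormedSpace ℂ F] (T : E →L[ℂ] F)
    (V : Submodule ℂ F) [FiniteDimensional ℂ V] (h : ∀ x, T x ∈ V) : IsCompactOperator T := by
  have := FiniteDimensional.proper ℂ V
  have hV : IsCompactOperator (T.codRestrict V h) :=
    isCompactOperator_of_locallyCompactSpace_dom (T.codRestrict V h)
  exact hV.clm_comp V.subtypeL

variable {B : Type u} [NonUnitalCStarAlgebra B]
  {H : Type u} [NormedAddCommGroup H] [InnerProductSpace ℂ H] [CompleteSpace H]

theorem rankOne_mem_compactIdeal (x y : H) : rankOne ℂ x y ∈ compactIdeal H :=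
  isCompactOperator_of_forall_apply_mem _ (ℂ ∙ x) fun _ =>
    Submodule.smul_mem _ _ (Submodule.mem_span_singleton_self x)

theorem compactIdeal_ne_bot [Nontrivial H] : compactIdeal H ≠ ⊥ := by
  intro h
  obtain ⟨v, hv⟩ := exists_ne (0 : H)
  exact rankOne_ne_zero hv hv (h.le (rankOne_mem_compactIdeal v v))

theorem IsIrreducibleRep.denseRange_apply {π : B →⋆ₙₐ[ℂ] (H →L[ℂ] H)} (hπ : IsIrreducibleRep π)
    {b : B} {v : H} (hv : π b v ≠ 0) : DenseRange fun a => π a v := by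
  let orbit : B →ₗ[ℂ] H :=
    { toFun := fun a => π a v
      map_add' := fun a c => by rw [map_add, add_apply]
      map_smul' := fun c a => by rw [map_smul, smul_apply, RingHom.id_apply] }
  let V := (LinearMap.range orbit).topologicalClosure
  have hinv : ∀ a : B, ∀ x ∈ V, π a x ∈ V := by
    refine fun a x hx => map_mem_closure (π a).continuous hx ?_
    rintro _ ⟨c, rfl⟩
    exact ⟨a * c, by simp [orbit]⟩
  have hbV : π b v ∈ V := Submodule.le_topologicalClosure _ ⟨b, rfl⟩
  rcases hπ V (Submodule.isClosed_topologicalClosure _) hinv with hV | hV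
  · exact absurd ((Submodule.mem_bot ℂ).1 (hV ▸ hbV)) hv
  · exact Submodule.dense_iff_topologicalClosure_eq_top.2 hV

theorem IsMinimalProjection.exists_forall_apply_mem_span {p : B} (hp : IsMinimalProjection p)
    {π : B →⋆ₙₐ[ℂ] (H →L[ℂ] H)} (hπ : IsIrreducibleRep π) : ∃ u, ∀ w, π p w ∈ ℂ ∙ u := by
  by_cases h0 : π p = 0
  · exact ⟨0, fun w => by rw [h0]; exact zero_mem _⟩
  obtain ⟨x, hx⟩ : ∃ x, π p x ≠ 0 := by
    by_contra! h
    exact h0 (ContinuousLinearMap.ext h)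
  have hdense : DenseRange fun a => π a (π p x) := hπ.denseRange_apply (b := p) <| by
    rwa [← mul_apply_eq_comp, ← map_mul, hp.isStarProjection.isIdempotentElem]
  have hclosed : IsClosed {w | π p w ∈ ℂ ∙ π p x} :=
    (Submodule.closed_of_finiteDimensional (ℂ ∙ π p x)).preimage (π p).continuous
  refine ⟨π p x, fun w => hdense.induction_on w hclosed fun a => ?_⟩
  obtain ⟨c, hc⟩ := hp.exists_smul a
  have : π p (π a (π p x)) = c • π p x := by
    rw [← smul_apply, ← map_smul, ← hc, map_mul, map_mul, mul_apply_eq_comp, mul_apply_eq_comp]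
  exact this ▸ Submodule.smul_mem _ c (Submodule.mem_span_singleton_self _)

theorem atomicIdeal_le_ccrIdeal : atomicIdeal B ≤ ccrIdeal B :=
  atomicIdeal_le fun _ hp _ _ _ _ π hπ =>
    have ⟨u, hu⟩ := hp.exists_forall_apply_mem_span hπ
    isCompactOperator_of_forall_apply_mem (π _) (ℂ ∙ u) hu

/-- A representation `φ` of `B` on `H` is nondegenerate if `φ(B) H` spans a dense subspace. These
are the representations that extend from an ideal to the whole algebra. -/
def IsNondegenerateRep (φ : B →⋆ₙₐ[ℂ] (H →L[ℂ] H)) : Prop :=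
  Dense (Submodule.span ℂ (Set.range fun p : B × H => φ p.1 p.2) : Set H)

theorem IsNondegenerateRep.ext_mul {φ : B →⋆ₙₐ[ℂ] (H →L[ℂ] H)} (hφ : IsNondegenerateRep φ)
    {S T : H →L[ℂ] H} (h : ∀ b, S * φ b = T * φ b) : S = T := by
  refine ContinuousLinearMap.ext_on hφ ?_
  rintro _ ⟨⟨b, v⟩, rfl⟩
  exact DFunLike.congr_fun (h b) v

theorem exists_apply_eq_of_rankOne_mem_range {φ : B →⋆ₙₐ[ℂ] (H →L[ℂ] H)}
    (h : ∀ x y, rankOne ℂ x y ∈ Set.range φ) {v : H} (hv : v ≠ 0) (w : H) :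
    ∃ b, φ b v = w := by
  obtain ⟨b, hb⟩ := h w v
  refine ⟨(inner ℂ v v)⁻¹ • b, ?_⟩
  rw [map_smul, hb, smul_apply, rankOne_apply, inv_smul_smul₀ (inner_self_ne_zero.2 hv)]

theorem isNondegenerateRep_of_rankOne_mem_range {φ : B →⋆ₙₐ[ℂ] (H →L[ℂ] H)}
    (h : ∀ x y, rankOne ℂ x y ∈ Set.range φ) : IsNondegenerateRep φ := by
  refine Dense.mono Submodule.subset_span (Function.Surjective.denseRange fun w => ?_)
  rcases eq_or_ne w 0 with rfl | hw
  · exact ⟨(0, 0), map_zero _⟩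
  · obtain ⟨b, hb⟩ := exists_apply_eq_of_rankOne_mem_range h hw w
    exact ⟨(b, w), hb⟩

theorem isIrreducibleRep_of_rankOne_mem_range {π : B →⋆ₙₐ[ℂ] (H →L[ℂ] H)}
    (h : ∀ x y, rankOne ℂ x y ∈ Set.range π) : IsIrreducibleRep π := by
  refine fun V _ hinv => or_iff_not_imp_left.2 fun hV => eq_top_iff.2 fun w _ => ?_
  obtain ⟨v, hvV, hv⟩ := V.exists_mem_ne_zero_of_ne_bot hV
  obtain ⟨b, rfl⟩ := exists_apply_eq_of_rankOne_mem_range h hv w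
  exact hinv b v hvV

namespace ClosedIdeal

/-- The kernel of a representation, as a closed ideal. -/
def ker (π : B →⋆ₙₐ[ℂ] (H →L[ℂ] H)) : ClosedIdeal B where
  carrier := {b | π b = 0}
  add_mem' {a b} (ha : π a = 0) (hb : π b = 0) := by
    rw [Set.mem_ofPred_eq, map_add, ha, hb, add_zero]
  zero_mem' := map_zero π
  smul_mem' c b (hb : π b = 0) := by rw [Set.mem_ofPred_eq, map_smul, hb, smul_zero]
  mul_mem_left' a b (hb : π b = 0) := by rw [Set.mem_ofPred_eq, map_mul, hb, mul_zero]
  mul_mem_right' a b (hb : π b = 0) := by rw [Set.mem_ofPred_eq, map_mul, hb, zero_mul]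
  isClosed' := isClosed_singleton.preimage (map_continuous π)

theorem IsEssential.injective_of_restrict {J : ClosedIdeal B} (hJ : J.IsEssential)
    {π : B →⋆ₙₐ[ℂ] (H →L[ℂ] H)} (hπ : ∀ j ∈ J, π j = 0 → j = 0) : Function.Injective π := by
  have hker : ker π = ⊥ := hJ _ (le_bot_iff.1 fun x hx => hπ x hx.2 hx.1)
  exact (injective_iff_map_eq_zero π).2 fun x hx => hker.le hx

section Extension

variable (J : ClosedIdeal B) (φ : J.toStarSubalgebra →⋆ₙₐ[ℂ] (H →L[ℂ] H))

/-- Left multiplication `j ↦ b j` as a map `J → J`. -/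
def mulLeft (b : B) (j : J.toStarSubalgebra) : J.toStarSubalgebra := ⟨b * j, J.mul_mem_left b j.2⟩

/-- Right multiplication `j ↦ j b` as a map `J → J`. -/
def mulRight (b : B) (j : J.toStarSubalgebra) : J.toStarSubalgebra :=
  ⟨j * b, J.mul_mem_right b j.2⟩

/-- An approximate unit `(e)` of `J` gives `φ(b e) ∑ φ(j) v → ∑ φ(b j) v`, where `‖b e‖ ≤ ‖b‖`. -/
theorem norm_linearCombination_mulLeft_le (b : B) (x : J.toStarSubalgebra × H →₀ ℂ) :
    ‖Finsupp.linearCombination ℂ (fun p => φ (J.mulLeft b p.1) p.2) x‖ ≤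
      ‖b‖ * ‖Finsupp.linearCombination ℂ (fun p => φ p.1 p.2) x‖ := by
  let _ : PartialOrder J.toStarSubalgebra := CStarAlgebra.spectralOrder _
  have _ : StarOrderedRing J.toStarSubalgebra := CStarAlgebra.spectralOrderedRing _
  have hl := CStarAlgebra.increasingApproximateUnit J.toStarSubalgebra
  set l := CStarAlgebra.approximateUnit J.toStarSubalgebra
  set y := Finsupp.linearCombination ℂ (fun p : J.toStarSubalgebra × H => φ p.1 p.2) x with hy
  have hgen (p : J.toStarSubalgebra × H) :
      Tendsto (fun e => φ (J.mulLeft b e) (φ p.1 p.2)) l (𝓝 (φ (J.mulLeft b p.1) p.2)) := by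
    have hcont : Continuous fun j => φ (J.mulLeft b j) p.2 := by
      have : Continuous (J.mulLeft b) :=
        (continuous_const.mul continuous_subtype_val).subtype_mk _
      fun_prop
    refine ((hcont.tendsto p.1).comp (hl.tendsto_mul_right p.1)).congr fun e => ?_
    have : J.mulLeft b (e * p.1) = J.mulLeft b e * p.1 := Subtype.ext (mul_assoc b e p.1).symm
    rw [Function.comp_apply, this, map_mul, mul_apply_eq_comp]
  have hlim : Tendsto (fun e => ‖φ (J.mulLeft b e) y‖) l
      (𝓝 ‖Finsupp.linearCombination ℂ (fun p => φ (J.mulLeft b p.1) p.2) x‖) := by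
    simp only [hy, Finsupp.linearCombination_apply, Finsupp.sum, map_sum, map_smul]
    exact (tendsto_finsetSum _ fun p _ => (hgen p).const_smul (x p)).norm
  refine le_of_tendsto hlim ?_
  filter_upwards [hl.eventually_norm] with e he
  calc ‖φ (J.mulLeft b e) y‖ ≤ ‖φ (J.mulLeft b e)‖ * ‖y‖ := ContinuousLinearMap.le_opNorm _ _
    _ ≤ ‖b * (e : B)‖ * ‖y‖ := by gcongr; exact NonUnitalStarAlgHom.norm_apply_le φ _
    _ ≤ ‖b‖ * ‖y‖ := by
      gcongr
      exact (norm_mul_le _ _).trans (mul_le_of_le_one_right (norm_nonneg b) he)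

/-- The operator `φ(j) v ↦ φ(b j) v` by which `b` acts in the extension of a nondegenerate
representation `φ` of `J`; without nondegeneracy, it is a junk value. -/
noncomputable def extendOperator (b : B) : H →L[ℂ] H :=
  (Finsupp.linearCombination ℂ fun p : J.toStarSubalgebra × H =>
    φ (J.mulLeft b p.1) p.2).extendOfNorm (Finsupp.linearCombination ℂ fun p => φ p.1 p.2)

variable {J φ}

theorem extendOperator_mul (hφ : IsNondegenerateRep φ) (b : B) (j : J.toStarSubalgebra) :
    J.extendOperator φ b * φ j = φ (J.mulLeft b j) := by
  have hdense : DenseRange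
      (Finsupp.linearCombination ℂ fun p : J.toStarSubalgebra × H => φ p.1 p.2) := by
    rwa [IsNondegenerateRep, ← Finsupp.range_linearCombination] at hφ
  ext v
  simpa [extendOperator] using LinearMap.extendOfNorm_eq hdense
    ⟨_, J.norm_linearCombination_mulLeft_le φ b⟩ (Finsupp.single (j, v) 1)

theorem mul_extendOperator (hφ : IsNondegenerateRep φ) (b : B) (j : J.toStarSubalgebra) :
    φ j * J.extendOperator φ b = φ (J.mulRight b j) :=
  hφ.ext_mul fun k => by
    have : j * J.mulLeft b k = J.mulRight b j * k := Subtype.ext (mul_assoc (j : B) b k).symm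
    rw [mul_assoc, extendOperator_mul hφ, ← map_mul, ← map_mul, this]

/-- The extension of a nondegenerate representation of a closed ideal to the whole algebra. -/
noncomputable def extendRep (hφ : IsNondegenerateRep φ) : B →⋆ₙₐ[ℂ] (H →L[ℂ] H) where
  toFun := J.extendOperator φ
  map_smul' c b := hφ.ext_mul fun j => by
    have : J.mulLeft (c • b) j = c • J.mulLeft b j := Subtype.ext (smul_mul_assoc c b (j : B))
    rw [MonoidHom.id_apply, smul_mul_assoc, extendOperator_mul hφ, extendOperator_mul hφ, this,
      map_smul]
  map_zero' := hφ.ext_mul fun j => by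
    have : J.mulLeft 0 j = 0 := Subtype.ext (zero_mul (j : B))
    rw [extendOperator_mul hφ, this, map_zero, zero_mul]
  map_add' a b := hφ.ext_mul fun j => by
    have : J.mulLeft (a + b) j = J.mulLeft a j + J.mulLeft b j :=
      Subtype.ext (add_mul a b (j : B))
    rw [add_mul, extendOperator_mul hφ, extendOperator_mul hφ, extendOperator_mul hφ, this,
      map_add]
  map_mul' a b := hφ.ext_mul fun j => by
    have : J.mulLeft (a * b) j = J.mulLeft a (J.mulLeft b j) := Subtype.ext (mul_assoc a b (j : B))
    rw [mul_assoc, extendOperator_mul hφ, extendOperator_mul hφ, extendOperator_mul hφ, this]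
  map_star' b := hφ.ext_mul fun j => by
    have : J.mulLeft (star b) j = star (J.mulRight b (star j)) := Subtype.ext <| by
      simp [mulLeft, mulRight]
    rw [extendOperator_mul hφ, this, map_star, ← mul_extendOperator hφ, star_mul, map_star,
      star_star]

theorem extendRep_coe (hφ : IsNondegenerateRep φ) (j : J.toStarSubalgebra) :
    extendRep hφ j = φ j :=
  hφ.ext_mul fun k => (extendOperator_mul hφ j k).trans (map_mul φ j k)

end Extension

end ClosedIdeal

theorem ccrIdeal_le_of_isEssential {J : ClosedIdeal B} (hJ : J.IsEssential)
    (e : J.toStarSubalgebra ≃⋆ₐ[ℂ] (compactIdeal H).toStarSubalgebra) : ccrIdeal B ≤ J := by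
  let φ : J.toStarSubalgebra →⋆ₙₐ[ℂ] (H →L[ℂ] H) :=
    (NonUnitalStarSubalgebraClass.subtype (compactIdeal H).toStarSubalgebra).comp
      (e : J.toStarSubalgebra →⋆ₙₐ[ℂ] (compactIdeal H).toStarSubalgebra)
  have hφ_inj : Function.Injective φ := Subtype.val_injective.comp e.injective
  have hφ_range : ∀ T ∈ compactIdeal H, ∃ j, φ j = T := fun T hT =>
    ⟨e.symm ⟨T, hT⟩, congrArg Subtype.val (e.apply_symm_apply ⟨T, hT⟩)⟩
  have hφ : IsNondegenerateRep φ := isNondegenerateRep_of_rankOne_mem_range fun x y =>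
    hφ_range _ (rankOne_mem_compactIdeal x y)
  let π := ClosedIdeal.extendRep hφ
  have hπφ (j : J.toStarSubalgebra) : π j = φ j := ClosedIdeal.extendRep_coe hφ j
  have hπ_irr : IsIrreducibleRep π := isIrreducibleRep_of_rankOne_mem_range fun x y =>
    have ⟨j, hj⟩ := hφ_range _ (rankOne_mem_compactIdeal x y)
    ⟨j, (hπφ j).trans hj⟩
  have hπ_inj : Function.Injective π := hJ.injective_of_restrict fun j hjJ hj =>
    congrArg Subtype.val <|
      (map_eq_zero_iff φ hφ_inj).1 ((hπφ ⟨j, hjJ⟩).symm.trans hj)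
  intro b hb
  obtain ⟨j, hj⟩ := hφ_range (π b) (hb H π hπ_irr)
  exact hπ_inj ((hπφ j).trans hj) ▸ j.2

end Representations

namespace IsFullyNoncommutative

variable {A : Type u} [NonUnitalCStarAlgebra A] {α : Ordinal.{u}}

theorem exists_starAlgEquiv (hA : IsFullyNoncommutative A) (hα : cbIdeal A α ≠ ⊤) :
    ∃ (H : Type u) (_ : NormedAddCommGroup H) (_ : InnerProductSpace ℂ H) (_ : CompleteSpace H),
      Nontrivial H ∧ Nonempty ((atomicIdeal (cbIdeal A α).Quotient).toStarSubalgebra ≃⋆ₐ[ℂ]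
        (compactIdeal H).toStarSubalgebra) := by
  have h := hA.2 α hα
  rwa [cbIdeal_add_one, ClosedIdeal.subquotient_pullback] at h

theorem atomicIdeal_ne_bot (hA : IsFullyNoncommutative A) (hα : cbIdeal A α ≠ ⊤) :
    atomicIdeal (cbIdeal A α).Quotient ≠ ⊥ := by
  obtain ⟨H, _, _, _, _, ⟨e⟩⟩ := hA.exists_starAlgEquiv hα
  have := ClosedIdeal.nontrivial_toStarSubalgebra_iff.2 (compactIdeal_ne_bot (H := H))
  exact ClosedIdeal.nontrivial_toStarSubalgebra_iff.1 e.toEquiv.nontrivial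

theorem atomicIdeal_eq_ccrIdeal (hA : IsFullyNoncommutative A) (hα : cbIdeal A α ≠ ⊤) :
    atomicIdeal (cbIdeal A α).Quotient = ccrIdeal (cbIdeal A α).Quotient := by
  obtain ⟨H, _, _, _, _, ⟨e⟩⟩ := hA.exists_starAlgEquiv hα
  have htop := cbIdeal_cbHeight fun _ => hA.atomicIdeal_ne_bot
  exact atomicIdeal_le_ccrIdeal.antisymm
    (ccrIdeal_le_of_isEssential (isEssential_atomicIdeal_quotient htop α) e)

end IsFullyNoncommutative

theorem mainTheorem9 (A : Type u) [NonUnitalCStarAlgebra A] (hA : IsFullyNoncommutative A) :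
    IsCantorBendixsonSeries (cbHeight A) (cbIdeal A) ∧
      IsGCRSeries (cbHeight A) (cbIdeal A) ∧
      ∀ (γ : Ordinal.{u}) (J : Ordinal.{u} → ClosedIdeal A), IsGCRSeries γ J →
        γ = cbHeight A ∧ ∀ α ≤ γ, J α = cbIdeal A α := by
  have hCB : IsCantorBendixsonSeries (cbHeight A) (cbIdeal A) :=
    isCantorBendixsonSeries_cbIdeal fun _ => hA.atomicIdeal_ne_bot
  have hGCR : IsGCRSeries (cbHeight A) (cbIdeal A) := hCB.congr fun _ hα =>
    hA.atomicIdeal_eq_ccrIdeal (cbIdeal_ne_top_of_lt_cbHeight hα)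
  exact ⟨hCB, hGCR, fun _ _ hJ => hJ.unique hGCR⟩
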